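/- Let $0<\alpha<1$ and $T>0$. For real parameters $\gamma>0$, $\gamma>\beta$, $\mu,\delta$, let \[ e^{\mu,\delta}_{\gamma,\beta}(z)=\sum_{n=0}^{\infty}\frac{z^n}{\Gamma(\gamma n+\mu)\,\Gamma(\delta-\beta n)} \] be the Wright-type function, where $1/\Gamma$ is taken to be $0$ at the poles of $\Gamma$. For $x\in\mathbb R$ and $t>0$ put \[ P(x,t)=\frac{t^{\frac{\alpha}{2}-1}}{2}\,e^{1,\frac{\alpha}{2}}_{1,\frac{\alpha}{2}}\!\left(-|x|\,t^{-\frac{\alpha}{2}}\right), \] and let \[ G(x,t,\xi,\tau)=\sum_{m=-\infty}^{+\infty}\bigl[P(2m+x-\xi,\,t-\tau)-P(2m+x+\xi,\,t-\tau)\bigr] \] be the Green function of the Dirichlet problem on $(0,1)$ for the subdiffusion equation $\partial_{0t}^{\alpha}u-u_{xx}=f$ with the Caputo derivative of order $\alpha$ in time. Then the power series of $e^{1,\alpha/2}_{1,\alpha/2}(z)$ converges absolutely for every real $z$, and there is a constant $C>0$, depending only on $\alpha$ and $T$, such that for all $x\in[0,1]$, $\xi\in(0,1)$ and $0<\tau<t\le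 T$ the series defining $G(x,t,\xi,\tau)$ converges absolutely and \[ |G(x,t,\xi,\tau)|\le C\,|t-\tau|^{\frac{\alpha}{2}-1}. \] -/

import Mathlib

/-- The `n`-th term of the power series of the Wright-type function `e^{μ,δ}_{γ,β}`:
`z^n / (Γ(γ n + μ) Γ(δ - β n))`. At a pole of `Γ` Mathlib's `Real.Gamma` is `0`, so that the
quotient is `0`, in accordance with the usual convention that `1/Γ` vanishes at the poles. -/
noncomputable def wrightTerm (γ β μ δ z : ℝ) (n : ℕ) : ℝ :=
  z ^ n / (Real.Gamma (γ * n + μ) * Real.Gamma (δ - β * n))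

/-- The Wright-type function `e^{μ,δ}_{γ,β}(z) = ∑_{n ≥ 0} z^n / (Γ(γ n + μ) Γ(δ - β n))`. -/
noncomputable def wrightE (γ β μ δ z : ℝ) : ℝ :=
  ∑' n : ℕ, wrightTerm γ β μ δ z n

/-- `P(x,t) = (t^{α/2-1} / 2) e^{1,α/2}_{1,α/2}(-|x| t^{-α/2})`, for `t > 0`. -/
noncomputable def kernelP (α x t : ℝ) : ℝ :=
  t ^ (α / 2 - 1) / 2 * wrightE 1 (α / 2) 1 (α / 2) (-|x| * t ^ (-(α / 2)))

/-- The `m`-th term of the image series: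
`P(2m + x - ξ, t - τ) - P(2m + x + ξ, t - τ)`. -/
noncomputable def greenTerm (α x t ξ τ : ℝ) (m : ℤ) : ℝ :=
  kernelP α (2 * m + x - ξ) (t - τ) - kernelP α (2 * m + x + ξ) (t - τ)

/-- The Green function `G(x,t,ξ,τ)` of the Dirichlet problem for the Caputo subdiffusion
equation of order `α` on `(0,1)`, as the image series over all integers. -/
noncomputable def greenG (α x t ξ τ : ℝ) : ℝ :=
  ∑' m : ℤ, greenTerm α x t ξ τ m

open Real MeasureTheory Set

/-! Put b = α/2 < 1/2. Reflection and Euler's integral for Γ(1 - b + bn) turn the series at -y into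
an integral over r > 0 whose integrand is at most exp(-r) r^(-b) exp(-y r^b cos(πb)) in modulus
(`abs_wrightE_neg_le_integral`). As cos(πb) > 0, the last factor can be dropped, giving boundedness,
or traded for a power, giving decay y^(-1/α). For times up to T the image terms are then O(|m +
1/2|^(-1/α)) times the time factor, which is summable because 1/α > 1. -/

/-- Euler's reflection formula, solved for `1 / Γ`; it also holds at the poles. -/
theorem inv_Gamma_eq_Gamma_one_sub_mul_sin {s : ℝ} (hs : s < 1) :
    (Gamma s)⁻¹ = Gamma (1 - s) * (sin (π * s) / π) := by
  have hpos : 0 < Gamma (1 - s) := Gamma_pos_of_pos (by linarith)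
  have h := Gamma_mul_Gamma_one_sub s
  rw [← eq_div_iff hpos.ne'] at h
  rw [h, inv_div, div_div_eq_mul_div, mul_div_assoc]

/-- Log-convexity of Γ between n and 1 gives Γ(n)^b, and b < 1/2. -/
theorem Gamma_convex_combination_le_sqrt_factorial {b : ℝ} (hb0 : 0 < b) (hb : b < 1 / 2) {n : ℕ}
    (hn : 1 ≤ n) : Gamma (1 - b + b * n) ≤ √(n.factorial : ℝ) := by
  have hn' : (0 : ℝ) < n := by exact_mod_cast hn
  have h := Gamma_mul_add_mul_le_rpow_Gamma_mul_rpow_Gamma hn' one_pos hb0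
    (by linarith : 0 < 1 - b) (by ring)
  obtain ⟨k, rfl⟩ : ∃ k, n = k + 1 := ⟨n - 1, by omega⟩
  have hk : Gamma ((k + 1 : ℕ) : ℝ) = k.factorial := by
    push_cast
    exact Gamma_nat_eq_factorial k
  rw [Gamma_one, one_rpow, mul_one, mul_one, hk] at h
  calc Gamma (1 - b + b * (k + 1 : ℕ)) = Gamma (b * (k + 1 : ℕ) + (1 - b)) := by ring_nf
    _ ≤ (k.factorial : ℝ) ^ b := h
    _ ≤ ((k + 1).factorial : ℝ) ^ b := by
        gcongr
        omega
    _ ≤ ((k + 1).factorial : ℝ) ^ (1 / 2 : ℝ) := by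
        apply rpow_le_rpow_of_exponent_le _ hb.le
        exact_mod_cast Nat.one_le_iff_ne_zero.mpr (Nat.factorial_ne_zero _)
    _ = √((k + 1).factorial : ℝ) := (sqrt_eq_rpow _).symm

theorem summable_pow_div_sqrt_factorial (z : ℝ) :
    Summable fun n : ℕ ↦ z ^ n / √(n.factorial : ℝ) := by
  have h1 := summable_pow_div_factorial ((2 * z) ^ 2)
  have h2 : Summable fun n : ℕ ↦ ((1 / 4 : ℝ)) ^ n :=
    summable_geometric_of_lt_one (by norm_num) (by norm_num)
  -- Split off (1/2)^n and bound the product by the sum of squares.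
  refine (h1.add h2).of_norm_bounded fun n ↦ ?_
  have hf : (0 : ℝ) < n.factorial := by positivity
  have e1 : ((2 * z) ^ 2) ^ n / (n.factorial : ℝ) = (|2 * z| ^ n / √(n.factorial : ℝ)) ^ 2 := by
    rw [div_pow, sq_sqrt hf.le, ← pow_mul, ← pow_mul, mul_comm n 2, pow_mul |2 * z|, sq_abs,
      ← pow_mul]
  have e2 : (1 / 4 : ℝ) ^ n = ((1 / 2 : ℝ) ^ n) ^ 2 := by
    rw [← pow_mul, mul_comm, pow_mul]
    norm_num
  have e3 : ‖z ^ n / √(n.factorial : ℝ)‖ =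
      |2 * z| ^ n / √(n.factorial : ℝ) * (1 / 2 : ℝ) ^ n := by
    rw [norm_div, norm_pow, norm_eq_abs, norm_of_nonneg (sqrt_nonneg _), div_mul_eq_mul_div,
      ← mul_pow, abs_mul, abs_two]
    ring_nf
  rw [e1, e2, e3]
  have ha : 0 ≤ |2 * z| ^ n / √(n.factorial : ℝ) := by positivity
  have hb : 0 ≤ (1 / 2 : ℝ) ^ n := by positivity
  nlinarith [sq_nonneg (|2 * z| ^ n / √(n.factorial : ℝ) - (1 / 2 : ℝ) ^ n), mul_nonneg ha hb]

theorem summable_pow_div_factorial_mul_Gamma {b : ℝ} (hb0 : 0 < b) (hb : b < 1 / 2) (z : ℝ) :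
    Summable fun n : ℕ ↦ |z| ^ n / n.factorial * Gamma (1 - b + b * n) := by
  rw [← summable_nat_add_iff 1]
  refine ((summable_nat_add_iff 1).mpr (summable_pow_div_sqrt_factorial |z|)).of_nonneg_of_le
    (fun n ↦ ?_) fun n ↦ ?_
  · have : 0 < Gamma (1 - b + b * (n + 1 : ℕ)) := by
      apply Gamma_pos_of_pos
      push_cast
      nlinarith [mul_nonneg hb0.le n.cast_nonneg (α := ℝ)]
    positivity
  · have hf : (0 : ℝ) < (n + 1).factorial := by positivity
    calc |z| ^ (n + 1) / (n + 1).factorial * Gamma (1 - b + b * (n + 1 : ℕ))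
        ≤ |z| ^ (n + 1) / (n + 1).factorial * √((n + 1).factorial : ℝ) := by
          gcongr
          exact Gamma_convex_combination_le_sqrt_factorial hb0 hb (by omega)
      _ = |z| ^ (n + 1) / √((n + 1).factorial : ℝ) := by
          rw [div_mul_eq_mul_div, mul_div_assoc, sqrt_div_self', mul_one_div]

theorem wrightTerm_eq {b : ℝ} (hb0 : 0 < b) (hb : b < 1 / 2) (z : ℝ) (n : ℕ) :
    wrightTerm 1 b 1 b z n =
      z ^ n / n.factorial * (sin (π * (b - b * n)) / π) * Gamma (1 - b + b * n) := by
  have hs : b - b * n < 1 := by nlinarith [mul_nonneg hb0.le n.cast_nonneg (α := ℝ)]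
  rw [wrightTerm, one_mul, Gamma_nat_eq_factorial, ← div_div, div_eq_mul_inv _ (Gamma _),
    inv_Gamma_eq_Gamma_one_sub_mul_sin hs]
  ring_nf

theorem abs_sin_div_pi_le_one (x : ℝ) : |sin x / π| ≤ 1 := by
  rw [abs_div, abs_of_pos pi_pos, div_le_one pi_pos]
  linarith [abs_sin_le_one x, pi_gt_three]

theorem summable_wrightTerm {b : ℝ} (hb0 : 0 < b) (hb : b < 1 / 2) (z : ℝ) :
    Summable (wrightTerm 1 b 1 b z) := by
  refine (summable_pow_div_factorial_mul_Gamma hb0 hb z).of_norm_bounded fun n ↦ ?_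
  have hG : 0 < Gamma (1 - b + b * n) :=
    Gamma_pos_of_pos (by nlinarith [mul_nonneg hb0.le n.cast_nonneg (α := ℝ)])
  rw [wrightTerm_eq hb0 hb, norm_mul, norm_mul, norm_of_nonneg hG.le, norm_div, norm_pow,
    norm_eq_abs, norm_natCast, norm_eq_abs]
  gcongr
  exact mul_le_of_le_one_right (by positivity) (abs_sin_div_pi_le_one _)

/-- The series is Im[e^(iπb) exp(-w e^(-iπb))]. Summing before taking absolute values keeps the
cancellation that yields decay. -/
theorem abs_tsum_pow_div_factorial_mul_sin_le (b w : ℝ) :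
    |∑' n : ℕ, (-w) ^ n / n.factorial * sin (π * (b - b * n))| ≤ exp (-(w * cos (π * b))) := by
  have h := (NormedSpace.expSeries_div_hasSum_exp
    (-(w : ℂ) * Complex.exp (-((π * b : ℝ) : ℂ) * Complex.I))).mul_left
      (Complex.exp (((π * b : ℝ) : ℂ) * Complex.I))
  rw [← Complex.exp_eq_exp_ℂ] at h
  have him := Complex.hasSum_im h
  have hterm : ∀ n : ℕ, (Complex.exp (((π * b : ℝ) : ℂ) * Complex.I) *
      ((-(w : ℂ) * Complex.exp (-((π * b : ℝ) : ℂ) * Complex.I)) ^ n / n.factorial)).im =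
      (-w) ^ n / n.factorial * sin (π * (b - b * n)) := by
    intro n
    have : Complex.exp (((π * b : ℝ) : ℂ) * Complex.I) *
        ((-(w : ℂ) * Complex.exp (-((π * b : ℝ) : ℂ) * Complex.I)) ^ n / n.factorial) =
        (((-w) ^ n / n.factorial : ℝ) : ℂ) *
          Complex.exp (((π * (b - b * n) : ℝ) : ℂ) * Complex.I) := by
      have hexp : Complex.exp (((π * (b - b * n) : ℝ) : ℂ) * Complex.I) =
          Complex.exp (((π * b : ℝ) : ℂ) * Complex.I) *
            Complex.exp (-((π * b : ℝ) : ℂ) * Complex.I) ^ n := by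
        rw [← Complex.exp_nat_mul, ← Complex.exp_add]
        push_cast
        ring_nf
      rw [hexp, mul_pow]
      push_cast
      ring
    rw [this, Complex.im_ofReal_mul, Complex.exp_ofReal_mul_I_im]
  simp_rw [hterm] at him
  rw [him.tsum_eq]
  refine (Complex.abs_im_le_norm _).trans ?_
  rw [norm_mul, Complex.norm_exp_ofReal_mul_I, one_mul, Complex.norm_exp]
  rw [← Complex.ofReal_neg, ← Complex.ofReal_neg, Complex.re_ofReal_mul,
    Complex.exp_ofReal_mul_I_re, cos_neg, neg_mul]

/-- The Wright function at `-y` is the integral over `r > 0` of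
`exp (-r) r ^ (-b) Im [exp (iπb) exp (-y r ^ b exp (-iπb))] / π`, which is dominated pointwise. -/
theorem abs_wrightE_neg_le_integral {b : ℝ} (hb0 : 0 < b) (hb : b < 1 / 2) (y : ℝ) {g : ℝ → ℝ}
    (hg : IntegrableOn g (Ioi 0))
    (hle : ∀ r, 0 < r →
      exp (-r) * r ^ (-b) * exp (-(y * r ^ b * cos (π * b))) ≤ g r) :
    |wrightE 1 b 1 b (-y)| ≤ ∫ r in Ioi 0, g r := by
  let c : ℕ → ℝ := fun n ↦ (-y) ^ n / n.factorial * (sin (π * (b - b * n)) / π)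
  let F : ℕ → ℝ → ℝ := fun n r ↦ c n * (exp (-r) * r ^ ((1 - b + b * n) - 1))
  have hs : ∀ n : ℕ, 0 < 1 - b + b * n := fun n ↦ by
    nlinarith [mul_nonneg hb0.le n.cast_nonneg (α := ℝ)]
  have hFint : ∀ n, IntegrableOn (F n) (Ioi 0) := fun n ↦
    (GammaIntegral_convergent (hs n)).const_mul _
  -- These integrals are exactly the absolute values of the Wright terms, so sum and integral may be
  -- exchanged.
  have hFnorm : Summable fun n ↦ ∫ r in Ioi 0, ‖F n r‖ := by
    refine (summable_wrightTerm hb0 hb (-y)).norm.congr fun n ↦ ?_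
    rw [wrightTerm_eq hb0 hb, norm_mul, norm_of_nonneg (Gamma_pos_of_pos (hs n)).le,
      Gamma_eq_integral (hs n), ← integral_const_mul]
    refine setIntegral_congr_fun measurableSet_Ioi fun r hr ↦ ?_
    have hr' : (0 : ℝ) < r := hr
    simp only [F, c, norm_mul]
    rw [norm_of_nonneg (exp_pos _).le, norm_of_nonneg (rpow_nonneg hr'.le _)]
  have hsum := hasSum_integral_of_summable_integral_norm hFint hFnorm
  have hE : wrightE 1 b 1 b (-y) = ∫ r in Ioi 0, ∑' n, F n r := by
    rw [wrightE, ← hsum.tsum_eq]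
    refine tsum_congr fun n ↦ ?_
    rw [wrightTerm_eq hb0 hb, Gamma_eq_integral (hs n), ← integral_const_mul]
  rw [hE, ← norm_eq_abs]
  refine norm_integral_le_of_norm_le hg ((ae_restrict_iff' measurableSet_Ioi).mpr
    (.of_forall fun r hr ↦ ?_))
  have hr' : (0 : ℝ) < r := hr
  refine le_trans ?_ (hle r hr')
  have hF : ∀ n, F n r = exp (-r) * r ^ (-b) / π *
      ((-(y * r ^ b)) ^ n / n.factorial * sin (π * (b - b * n))) := fun n ↦ by
    have hpow : r ^ ((1 - b + b * n) - 1) = r ^ (-b) * (r ^ b) ^ n := by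
      rw [← rpow_natCast (r ^ b), ← rpow_mul hr'.le, ← rpow_add hr']
      ring_nf
    simp only [F, c]
    rw [hpow, ← neg_mul, mul_pow]
    ring
  simp_rw [hF]
  rw [tsum_mul_left, norm_mul, norm_eq_abs, norm_eq_abs]
  have hnn : 0 ≤ exp (-r) * r ^ (-b) := by positivity
  gcongr
  · rw [abs_of_nonneg (by positivity)]
    exact div_le_self hnn (by linarith [pi_gt_three])
  · exact abs_tsum_pow_div_factorial_mul_sin_le b (y * r ^ b)

theorem cos_pi_mul_pos {b : ℝ} (hb0 : 0 < b) (hb : b < 1 / 2) : 0 < cos (π * b) :=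
  cos_pos_of_mem_Ioo ⟨by nlinarith [pi_pos], by nlinarith [pi_pos]⟩

theorem abs_wrightE_neg_le {b : ℝ} (hb0 : 0 < b) (hb : b < 1 / 2) {y : ℝ} (hy : 0 ≤ y) :
    |wrightE 1 b 1 b (-y)| ≤ Gamma (1 - b) := by
  have h1 : 0 < 1 - b := by linarith
  rw [Gamma_eq_integral h1]
  refine abs_wrightE_neg_le_integral hb0 hb y (GammaIntegral_convergent h1) fun r hr ↦ ?_
  rw [show 1 - b - 1 = -b by ring]
  refine mul_le_of_le_one_right (by positivity) (exp_le_one_iff.mpr ?_)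
  have := cos_pi_mul_pos hb0 hb
  rw [neg_nonpos]
  positivity

/-- Raise u/p ≤ exp(u/p) to the power p. -/
theorem exp_neg_le_mul_rpow_neg {p u : ℝ} (hp : 0 < p) (hu : 0 < u) :
    exp (-u) ≤ p ^ p * u ^ (-p) := by
  have h : (u / p) ^ p ≤ exp u := by
    calc (u / p) ^ p ≤ exp (u / p) ^ p := by
          gcongr
          linarith [add_one_le_exp (u / p)]
      _ = exp u := by rw [← exp_mul, div_mul_cancel₀ _ hp.ne']
  rw [div_rpow hu.le hp.le, div_le_iff₀ (by positivity)] at h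
  rw [exp_neg, rpow_neg hu.le, ← div_eq_mul_inv, le_div_iff₀ (by positivity), inv_mul_eq_div,
    div_le_iff₀ (exp_pos u)]
  linarith

/-- Power decay of order `1 / (2b) > 1` of the Wright function along the negative axis. -/
theorem abs_wrightE_neg_le_rpow {b : ℝ} (hb0 : 0 < b) (hb : b < 1 / 2) {y : ℝ} (hy : 0 < y) :
    |wrightE 1 b 1 b (-y)| ≤ (1 / (2 * b)) ^ (1 / (2 * b)) * cos (π * b) ^ (-(1 / (2 * b))) *
      Gamma (1 / 2 - b) * y ^ (-(1 / (2 * b))) := by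
  have hs : 0 < 1 / 2 - b := by linarith
  have hcos := cos_pi_mul_pos hb0 hb
  -- With this p, (r^b)^(-p) = r^(-1/2), and r^(-b-1/2) is still integrable at 0 since b < 1/2.
  set p := 1 / (2 * b) with hp
  have hp0 : 0 < p := by positivity
  have hbp : b * -p = -(1 / 2) := by
    rw [hp]
    field_simp
  rw [Gamma_eq_integral hs, mul_right_comm, ← integral_const_mul]
  refine abs_wrightE_neg_le_integral hb0 hb y ((GammaIntegral_convergent hs).const_mul _)
    fun r hr ↦ ?_
  have hrpow : r ^ (1 / 2 - b - 1) = r ^ (-b) * r ^ (-(1 / 2) : ℝ) := by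
    rw [← rpow_add hr]
    ring_nf
  calc exp (-r) * r ^ (-b) * exp (-(y * r ^ b * cos (π * b)))
      ≤ exp (-r) * r ^ (-b) * (p ^ p * (y * r ^ b * cos (π * b)) ^ (-p)) := by
        gcongr
        exact exp_neg_le_mul_rpow_neg hp0 (by positivity)
    _ = _ := by
        rw [mul_rpow (by positivity) hcos.le, mul_rpow hy.le (by positivity), ← rpow_mul hr.le,
          hbp, hrpow]
        ring

/-- A bound for the terms of the image series, uniform in the position and in bounded times. -/
theorem exists_forall_abs_kernelP_le {α T : ℝ} (hα0 : 0 < α) (hα1 : α < 1) (hT : 0 < T) :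
    ∃ E : ℝ, 0 < E ∧ ∀ w s : ℝ, -1 ≤ w → w ≤ 2 → 0 < s → s ≤ T → ∀ m : ℤ,
      |kernelP α (2 * m + w) s| ≤
        s ^ (α / 2 - 1) * (E * (1 / |(m : ℝ) + 1 / 2| ^ (1 / α))) := by
  have hb0 : 0 < α / 2 := by linarith
  have hb : α / 2 < 1 / 2 := by linarith
  have hp : 1 / (2 * (α / 2)) = 1 / α := by ring_nf
  have hA : 0 < Gamma (1 - α / 2) := Gamma_pos_of_pos (by linarith)
  have hG : 0 < Gamma (1 / 2 - α / 2) := Gamma_pos_of_pos (by linarith)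
  have hcos := cos_pi_mul_pos hb0 hb
  set A := Gamma (1 - α / 2)
  set B := (1 / α) ^ (1 / α) * cos (π * (α / 2)) ^ (-(1 / α)) * Gamma (1 / 2 - α / 2) with hB
  have hBpos : 0 < B := by positivity
  -- The first summand serves |m + 1/2| ≤ 2 by boundedness, the second the remaining m by decay.
  refine ⟨A * 2 ^ (1 / α) + B * (T ^ (-(α / 2))) ^ (-(1 / α)), by positivity, ?_⟩
  intro w s hw1 hw2 hs hsT m
  set k := |(m : ℝ) + 1 / 2| with hk
  have hkpos : 0 < k := by
    rw [hk, abs_pos]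
    intro h
    have : (2 * m + 1 : ℤ) = 0 := by
      have : (2 * m + 1 : ℝ) = 0 := by linarith
      exact_mod_cast this
    omega
  have hkp : 0 < k ^ (1 / α) := by positivity
  set y := |2 * (m : ℝ) + w| * s ^ (-(α / 2)) with hy
  have hE : |wrightE 1 (α / 2) 1 (α / 2) (-y)| ≤
      (A * 2 ^ (1 / α) + B * (T ^ (-(α / 2))) ^ (-(1 / α))) * (1 / k ^ (1 / α)) := by
    rw [mul_one_div, le_div_iff₀ hkp]
    rcases le_or_gt k 2 with h2 | h2
    · calc |wrightE 1 (α / 2) 1 (α / 2) (-y)| * k ^ (1 / α) ≤ A * 2 ^ (1 / α) := by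
            gcongr
            exact abs_wrightE_neg_le hb0 hb (by positivity)
        _ ≤ _ := le_add_of_nonneg_right (by positivity)
    -- Since 2m + w = (2m + 1) + (w - 1), its modulus is at least 2k - 2 ≥ k.
    · have hkw : k ≤ |2 * (m : ℝ) + w| := by
        have h3 : 2 * k ≤ |2 * (m : ℝ) + w| + |w - 1| := by
          calc 2 * k = |(2 * (m : ℝ) + w) - (w - 1)| := by
                rw [hk, ← abs_two, ← abs_mul, abs_two]
                ring_nf
            _ ≤ _ := abs_sub _ _
        have h4 : |w - 1| ≤ 2 := abs_le.mpr ⟨by linarith, by linarith⟩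
        linarith
      have hTs : T ^ (-(α / 2)) ≤ s ^ (-(α / 2)) :=
        rpow_le_rpow_of_nonpos hs hsT (by linarith)
      have hky : k * T ^ (-(α / 2)) ≤ y := by
        rw [hy]
        gcongr
      have hkT : 0 < k * T ^ (-(α / 2)) := by positivity
      have hdecay := abs_wrightE_neg_le_rpow hb0 hb (hkT.trans_le hky)
      rw [hp, ← hB] at hdecay
      calc |wrightE 1 (α / 2) 1 (α / 2) (-y)| * k ^ (1 / α)
          ≤ (B * (k * T ^ (-(α / 2))) ^ (-(1 / α))) * k ^ (1 / α) := by
            gcongr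
            have hp_nonpos : -(1 / α) ≤ 0 := neg_nonpos.mpr (by positivity)
            exact hdecay.trans
              (mul_le_mul_of_nonneg_left (rpow_le_rpow_of_nonpos hkT hky hp_nonpos) hBpos.le)
        _ = B * (T ^ (-(α / 2))) ^ (-(1 / α)) := by
            rw [mul_rpow hkpos.le (by positivity), rpow_neg hkpos.le]
            field_simp
        _ ≤ _ := le_add_of_nonneg_left (by positivity)
  have hspos : 0 < s ^ (α / 2 - 1) := by positivity
  rw [kernelP, abs_mul, abs_of_pos (half_pos hspos), neg_mul, ← hy]
  gcongr
  linarith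

theorem mainTheorem2 (α T : ℝ) (hα0 : 0 < α) (hα1 : α < 1) (hT : 0 < T) :
    (∀ z : ℝ, Summable (wrightTerm 1 (α / 2) 1 (α / 2) z)) ∧
    ∃ C : ℝ, 0 < C ∧ ∀ x t ξ τ : ℝ, x ∈ Set.Icc (0 : ℝ) 1 → ξ ∈ Set.Ioo (0 : ℝ) 1 →
      0 < τ → τ < t → t ≤ T →
        Summable (greenTerm α x t ξ τ) ∧
        |greenG α x t ξ τ| ≤ C * |t - τ| ^ (α / 2 - 1) := by
  refine ⟨summable_wrightTerm (by linarith) (by linarith), ?_⟩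
  obtain ⟨E, hE, hP⟩ := exists_forall_abs_kernelP_le hα0 hα1 hT
  have hsum : Summable fun m : ℤ ↦ 1 / |(m : ℝ) + 1 / 2| ^ (1 / α) :=
    (summable_one_div_int_add_rpow _ _).mpr ((one_lt_div hα0).mpr hα1)
  set S := ∑' m : ℤ, 1 / |(m : ℝ) + 1 / 2| ^ (1 / α) with hS
  have hS0 : 0 ≤ S := tsum_nonneg fun m ↦ by positivity
  -- The 2 counts the two images; the 1 makes the constant positive knowing only S ≥ 0.
  refine ⟨2 * E * S + 1, by positivity, fun x t ξ τ hx hξ hτ hτt htT ↦ ?_⟩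
  have hs : 0 < t - τ := by linarith
  have hbound : ∀ m : ℤ, ‖greenTerm α x t ξ τ m‖ ≤
      2 * E * (t - τ) ^ (α / 2 - 1) * (1 / |(m : ℝ) + 1 / 2| ^ (1 / α)) := fun m ↦ by
    have h1 := hP (x - ξ) (t - τ) (by linarith [hx.1, hξ.2]) (by linarith [hx.2, hξ.1]) hs
      (by linarith) m
    have h2 := hP (x + ξ) (t - τ) (by linarith [hx.1, hξ.1]) (by linarith [hx.2, hξ.2]) hs
      (by linarith) m
    rw [greenTerm, norm_eq_abs, add_sub_assoc, add_assoc]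
    refine (abs_sub _ _).trans ?_
    linarith
  have hmaj := hsum.hasSum.mul_left (2 * E * (t - τ) ^ (α / 2 - 1))
  refine ⟨hmaj.summable.of_norm_bounded hbound, ?_⟩
  have hle := tsum_of_norm_bounded hmaj hbound
  rw [greenG, abs_of_pos hs, ← norm_eq_abs]
  refine hle.trans ?_
  have : 0 < (t - τ) ^ (α / 2 - 1) := by positivity
  rw [← hS]
  linarith
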